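/- Let $\mathcal X,\mathcal A,\mathcal Z$ be measurable spaces (features, sensitive attributes, representations) and let $\mathcal Y$ be a finite label set. A domain $D$ is a probability distribution of $(X,A,Y)$ on $\mathcal X\times\mathcal A\times\mathcal Y$. Let $D^S_1,\dots,D^S_N$ ($N\ge 1$) be source domains and $D^T$ a target domain. Let $g$ be a stochastic representation mapping from $\mathcal X$ to $\mathcal Z$ and $\widehat h$ a stochastic hypothesis from $\mathcal Z$ to $\mathcal Y$ (both Markov kernels), and let $\widehat f=\widehat h\circ g$, so that $\widehat f(x)_{\hat y}=\int_{\mathcal Z}\widehat h(z)_{\hat y}\,g(dz\mid x)$ is the predicted probability of the label $\hat y$ at $x$. For a domain $D$ let $P_D^Y$ be the law of $Y$, let $P_D^Z$ be the law of the representation $Z\sim g(\cdot\mid X)$, and let $\epsilon^{\mathrm{Acc}}_D(\widehat f)=\mathbb E_D[\mathcal L(\widehat f(X),Y)]$ be the expected error. For probability distributions $P,P'$ let $$d_{JS}(P,P')=\sqrt{\tfrac12 D_{KL}\big(P\,\|\,\tfrac{P+P'}2\big)+\tfrac12 D_{KL}\big(P'\,\|\,\tfrac{P+P'}2\big)}$$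 be the Jensen-Shannon distance, with logarithms to any fixed base $b\ge2$ (so that the Jensen-Shannon divergence lies in $[0,1]$; the bases $2$ and $e$ are both allowed). Suppose that the loss satisfies $\mathcal L(\widehat f(x),y)=\sum_{\hat y\in\mathcal Y}\widehat f(x)_{\hat y}\,L(\hat y,y)$ for all $x\in\mathcal X$ and $y\in\mathcal Y$, where $L:\mathcal Y\times\mathcal Y\to[0,\infty)$ satisfies $L(\hat y,y)\ge c$ whenever $\hat y\ne y$, and $L(y,y)=0$. If $d_{JS}(P_{D^S_i}^Y,P_{D^T}^Y)\ge d_{JS}(P_{D^S_i}^Z,P_{D^T}^Z)$ for every $i\in\{1,\dots,N\}$, then $$\frac1N\sum_{i=1}^N\epsilon^{\mathrm{Acc}}_{D^S_i}(\widehat f)+\epsilon^{\mathrm{Acc}}_{D^T}(\widehat f)\ \ge\ \frac{c}{4|\mathcal Y|N}\sum_{i=1}^N\Big(d_{JS}(P_{D^S_i}^Y,P_{D^T}^Y)-d_{JS}(P_{D^S_i}^Z,P_{D^T}^Z)\Big)^4 .$$ -/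

import Mathlib

open MeasureTheory ProbabilityTheory InformationTheory
open scoped ENNReal

namespace DomainGeneralization

noncomputable section

/-- Kullback-Leibler divergence `D_KL(μ ‖ ν)` with logarithms to base `b`. -/
def klDivBase {α : Type*} [MeasurableSpace α] (b : ℝ) (μ ν : Measure α) : ℝ :=
  (klDiv μ ν).toReal / Real.log b

/-- The midpoint `(μ + ν) / 2` of two measures. -/
def midpointMeasure {α : Type*} [MeasurableSpace α] (μ ν : Measure α) : Measure α :=
  (2⁻¹ : ℝ≥0∞) • (μ + ν)

/-- Jensen-Shannon divergence with logarithms to base `b`. For probability measures both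
Kullback-Leibler terms are finite, since the densities are bounded by `2`. -/
def jsDiv {α : Type*} [MeasurableSpace α] (b : ℝ) (μ ν : Measure α) : ℝ :=
  1 / 2 * klDivBase b μ (midpointMeasure μ ν) + 1 / 2 * klDivBase b ν (midpointMeasure μ ν)

/-- Jensen-Shannon distance: the square root of the Jensen-Shannon divergence. -/
def jsDist {α : Type*} [MeasurableSpace α] (b : ℝ) (μ ν : Measure α) : ℝ :=
  Real.sqrt (jsDiv b μ ν)

/-- The marginal law of the features `X` in the domain with joint law `D` of `(X, A, Y)`. -/
def lawX {𝒳 𝒜 𝒴 : Type*} [MeasurableSpace 𝒳] [MeasurableSpace 𝒜] [MeasurableSpace 𝒴]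
    (D : Measure (𝒳 × 𝒜 × 𝒴)) : Measure 𝒳 :=
  D.map (fun w => w.1)

/-- The marginal law of the label `Y` in the domain with joint law `D` of `(X, A, Y)`. -/
def lawY {𝒳 𝒜 𝒴 : Type*} [MeasurableSpace 𝒳] [MeasurableSpace 𝒜] [MeasurableSpace 𝒴]
    (D : Measure (𝒳 × 𝒜 × 𝒴)) : Measure 𝒴 :=
  D.map (fun w => w.2.2)

/-- The law of the representation `Z`, drawn from `g X` where `X` is the feature in domain `D`. -/
def lawZ {𝒳 𝒜 𝒴 𝒵 : Type*} [MeasurableSpace 𝒳] [MeasurableSpace 𝒜] [MeasurableSpace 𝒴]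
    [MeasurableSpace 𝒵] (g : Kernel 𝒳 𝒵) (D : Measure (𝒳 × 𝒜 × 𝒴)) : Measure 𝒵 :=
  (lawX D).bind g

/-- The point `x ↦ f(x)` of the probability simplex over the finite label set given by a
stochastic predictor `f`: its `y`-th coordinate is the predicted probability of `y`. -/
def simplexMap {𝒳 𝒴 : Type*} [MeasurableSpace 𝒳] [Fintype 𝒴] [MeasurableSpace 𝒴]
    [MeasurableSingletonClass 𝒴] (f : Kernel 𝒳 𝒴) [IsMarkovKernel f] (x : 𝒳) :
    stdSimplex ℝ 𝒴 :=
  ⟨fun y => (f x).real {y}, fun _ => measureReal_nonneg, by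
    rw [sum_measureReal_singleton]; simp⟩

/-- The expected error `E_D[ℓ(f(X), Y)]` of a predictor `f` in the domain `D`. -/
def expectedError {𝒳 𝒜 𝒴 : Type*} [MeasurableSpace 𝒳] [MeasurableSpace 𝒜] [Fintype 𝒴]
    [MeasurableSpace 𝒴] (ℓ : stdSimplex ℝ 𝒴 → 𝒴 → ℝ) (f : 𝒳 → stdSimplex ℝ 𝒴)
    (D : Measure (𝒳 × 𝒜 × 𝒴)) : ℝ :=
  ∫ w, ℓ (f w.1) w.2.2 ∂D

end

end DomainGeneralization

namespace DomainGeneralization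

/-! Fix one source and the target, and let e, e' be the probabilities that the prediction differs
from the label. Wherever the predicted law of a label exceeds its true law, the excess is at most
the mass of wrong predictions of that label. A one-sided continuity estimate (`mul_log_sub_le`,
`jsSum_sub_le`) turns this into JS(Y) ≤ JS(predictions) + (√e + √e') / log b (`jsDiv_lawY_le`).
Predictions are drawn from Z through `h`, so data processing (`jsDiv_comp_le`) gives JS(predictions)
≤ JS(Z). For distances a ≥ d ≥ 0 of Y and Z, (a - d)² ≤ a² - d² ≤ (√e + √e') / log b. Squaring
bounds (a - d)⁴ by a multiple of e + e' (`jsDist_sub_pow_four_le`), and c * e is at most the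
expected error. Averaging over the sources finishes. -/

/-! ### Entropy inequalities for real numbers and finite vectors. -/

/-- The increments of `x ↦ x * log x` are increasing. -/
lemma mul_log_increment_mono {a d s : ℝ} (ha : 0 ≤ a) (hd : 0 ≤ d) (hs : 0 ≤ s) :
    (a + s) * Real.log (a + s) + (a + d) * Real.log (a + d)
      ≤ a * Real.log a + (a + d + s) * Real.log (a + d + s) := by
  rcases (add_nonneg hd hs).eq_or_lt with h0 | h0
  · obtain rfl : d = 0 := by linarith
    obtain rfl : s = 0 := by linarith
    simp
  have key := fun u v (hu : 0 ≤ u) (hv : 0 ≤ v) (huv : u + v = 1) =>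
    Real.convexOn_mul_log.2 (Set.mem_Ici.2 ha)
      (Set.mem_Ici.2 (by positivity : 0 ≤ a + d + s)) hu hv huv
  -- The two inner points are convex combinations of the outer ones with swapped weights, so the two
  -- convexity bounds add up to the claim.
  have hsum : d / (d + s) + s / (d + s) = 1 := by field_simp
  have h1 := key (d / (d + s)) (s / (d + s)) (by positivity) (by positivity) hsum
  have h2 := key (s / (d + s)) (d / (d + s)) (by positivity) (by positivity)
    (by rw [add_comm]; exact hsum)
  simp only [smul_eq_mul] at h1 h2
  rw [show d / (d + s) * a + s / (d + s) * (a + d + s) = a + s by field_simp; ring] at h1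
  rw [show s / (d + s) * a + d / (d + s) * (a + d + s) = a + d by field_simp; ring] at h2
  have e : d / (d + s) = 1 - s / (d + s) := by linarith
  rw [e] at h1 h2
  linarith

lemma log_one_add_le_sqrt {x : ℝ} (hx : 0 ≤ x) : Real.log (1 + x) ≤ Real.sqrt x := by
  have hs := Real.sqrt_nonneg x
  rw [Real.log_le_iff_le_exp (by positivity)]
  have h := Real.sum_le_exp_of_nonneg hs 4
  simp only [Finset.sum_range_succ, Finset.sum_range_zero, Nat.factorial] at h
  norm_num at h
  have hx2 := Real.sq_sqrt hx
  -- With s = √x, the cubic Taylor bound leaves s(1 - s/2 + s²/6) ≥ 0; the quadratic has its minimum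
  -- at 3/2 and is positive.
  nlinarith [mul_nonneg hs (sq_nonneg (Real.sqrt x - 3/2))]

/-- The map p ↦ p log p - (p + q) log (p + q) is decreasing, so only p < p' costs anything; this is
why a one-sided bound on p' suffices. In that case the difference splits into three logarithmic
terms, `h1`, `h2`, `h3`. -/
lemma mul_log_sub_le {p p' q r : ℝ} (hp : 0 ≤ p) (hp' : 0 ≤ p') (hq : 0 ≤ q) (hr : 0 ≤ r)
    (h : p' ≤ p + r) :
    p * Real.log p - p' * Real.log p' - (p + q) * Real.log (p + q)
      + (p' + q) * Real.log (p' + q) ≤ r + Real.sqrt (r * q) := by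
  rcases le_or_gt p' p with hle | hlt
  · have := mul_log_increment_mono hp' hq (sub_nonneg.2 hle)
    rw [add_sub_cancel, show p' + q + (p - p') = p + q by ring] at this
    have : 0 ≤ Real.sqrt (r * q) := Real.sqrt_nonneg _
    linarith
  have hpos : 0 < p' := hp.trans_lt hlt
  have hs : 0 < p' - p := sub_pos.2 hlt
  have h1 : p * Real.log p ≤ p * Real.log p' := by
    rcases hp.eq_or_lt with rfl | hp0
    · simp
    · exact mul_le_mul_of_nonneg_left (Real.log_le_log hp0 hlt.le) hp
  have h2 : (p + q) * Real.log (p' + q) - (p + q) * Real.log (p + q) ≤ p' - p := by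
    rcases (add_nonneg hp hq).eq_or_lt with h0 | h0
    · rw [← h0]; linarith
    · have h3 := Real.log_le_sub_one_of_pos (div_pos (by positivity : 0 < p' + q) h0)
      rw [Real.log_div (by positivity) h0.ne'] at h3
      have h4 := mul_le_mul_of_nonneg_left h3 h0.le
      have h5 : (p + q) * ((p' + q) / (p + q) - 1) = p' - p := by field_simp; ring
      linarith
  have h3 : (p' - p) * (Real.log (p' + q) - Real.log p') ≤ Real.sqrt (r * q) := by
    rw [← Real.log_div (by positivity) hpos.ne', add_div, div_self hpos.ne']
    calc _ ≤ (p' - p) * Real.sqrt (q / p') :=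
          mul_le_mul_of_nonneg_left (log_one_add_le_sqrt (by positivity)) hs.le
      _ = Real.sqrt ((p' - p) ^ 2 * (q / p')) := by
          rw [Real.sqrt_mul (sq_nonneg _), Real.sqrt_sq hs.le]
      _ ≤ _ := by
          apply Real.sqrt_le_sqrt
          -- The factor (p' - p) / p' ≤ 1 removes p' from the denominator.
          have : (p' - p) ^ 2 * (q / p') = (p' - p) * q * ((p' - p) / p') := by ring
          rw [this]
          calc _ ≤ (p' - p) * q * 1 := by
                gcongr
                rw [div_le_one hpos]; linarith
            _ ≤ _ := by rw [mul_one]; gcongr; linarith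
  linarith

/-- The function of two probability vectors whose affine image is the Jensen-Shannon
divergence. -/
noncomputable def jsSum {ι : Type*} [Fintype ι] (p q : ι → ℝ) : ℝ :=
  ∑ y, (p y * Real.log (p y) + q y * Real.log (q y) - (p y + q y) * Real.log (p y + q y))

lemma jsSum_comm {ι : Type*} [Fintype ι] (p q : ι → ℝ) : jsSum p q = jsSum q p :=
  Finset.sum_congr rfl fun y _ => by rw [add_comm (p y) (q y)]; ring

/-- Cauchy-Schwarz against the probability vector q makes the bound independent of the number of
labels; ∑ r ≤ 1 absorbs the linear term into the square root. -/
lemma jsSum_sub_le {ι : Type*} [Fintype ι] {p p' q r : ι → ℝ}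
    (hp : ∀ y, 0 ≤ p y) (hp' : ∀ y, 0 ≤ p' y) (hq : ∀ y, 0 ≤ q y) (hr : ∀ y, 0 ≤ r y)
    (hq1 : ∑ y, q y = 1) (h : ∀ y, p' y ≤ p y + r y) (hr1 : ∑ y, r y ≤ 1) :
    jsSum p q - jsSum p' q ≤ 2 * Real.sqrt (∑ y, r y) := by
  have h1 : jsSum p q - jsSum p' q ≤ ∑ y, (r y + Real.sqrt (r y) * Real.sqrt (q y)) := by
    rw [jsSum, jsSum, ← Finset.sum_sub_distrib]
    refine Finset.sum_le_sum fun y _ => ?_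
    have := mul_log_sub_le (hp y) (hp' y) (hq y) (hr y) (h y)
    rw [Real.sqrt_mul (hr y)] at this
    linarith
  have h2 := Real.sum_sqrt_mul_sqrt_le Finset.univ hr hq
  rw [hq1, Real.sqrt_one, mul_one] at h2
  rw [Finset.sum_add_distrib] at h1
  have h0 : 0 ≤ ∑ y, r y := Finset.sum_nonneg fun y _ => hr y
  have h3 : ∑ y, r y ≤ Real.sqrt (∑ y, r y) := Real.le_sqrt_of_sq_le (by nlinarith)
  linarith

/-! ### Midpoint measures and data processing. -/

section Midpoint
variable {α : Type*} [MeasurableSpace α]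

lemma midpointMeasure_comm (μ ν : Measure α) : midpointMeasure μ ν = midpointMeasure ν μ := by
  rw [midpointMeasure, midpointMeasure, add_comm]

instance (μ ν : Measure α) [IsProbabilityMeasure μ] [IsProbabilityMeasure ν] :
    IsProbabilityMeasure (midpointMeasure μ ν) := ⟨by
  simp only [midpointMeasure, Measure.smul_apply, Measure.add_apply, measure_univ, smul_eq_mul]
  rw [one_add_one_eq_two, ENNReal.inv_mul_cancel (by simp) (by simp)]⟩

lemma le_two_smul_midpointMeasure (μ ν : Measure α) : μ ≤ (2 : ℝ≥0∞) • midpointMeasure μ ν := by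
  rw [midpointMeasure, smul_smul, ENNReal.mul_inv_cancel (by simp) (by simp), one_smul]
  exact Measure.le_add_right le_rfl

lemma absolutelyContinuous_midpointMeasure (μ ν : Measure α) : μ ≪ midpointMeasure μ ν :=
  (Measure.absolutelyContinuous_of_le (le_two_smul_midpointMeasure μ ν)).trans
    Measure.smul_absolutelyContinuous

/-- The density is a.e. at most C, and `klFun` is bounded on [0, C]. Finiteness is what allows
`toReal` to preserve the data processing inequality. -/
lemma klDiv_ne_top_of_le_smul (μ ν : Measure α) [IsFiniteMeasure μ] [IsFiniteMeasure ν]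
    {C : ℝ≥0∞} (hC : C ≠ ∞) (h : μ ≤ C • ν) : klDiv μ ν ≠ ∞ := by
  have hac : μ ≪ ν :=
    (Measure.absolutelyContinuous_of_le h).trans Measure.smul_absolutelyContinuous
  have hbd : μ.rnDeriv ν ≤ᵐ[ν] fun _ => C := by
    refine ae_le_of_forall_setLIntegral_le_of_sigmaFinite (Measure.measurable_rnDeriv _ _)
      fun s _ _ => ?_
    calc _ ≤ μ s := Measure.setLIntegral_rnDeriv_le s
      _ ≤ (C • ν) s := h s
      _ = _ := by simp
  obtain ⟨K, hK⟩ := (isCompact_Icc (a := (0 : ℝ)) (b := C.toReal)).bddAbove_image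
    continuous_klFun.continuousOn
  rw [klDiv_eq_lintegral_klFun_of_ac hac]
  refine ((lintegral_mono_ae (g := fun _ => ENNReal.ofReal K) ?_).trans_lt ?_).ne
  · filter_upwards [hbd] with x hx
    exact ENNReal.ofReal_le_ofReal
      (hK ⟨_, ⟨ENNReal.toReal_nonneg, ENNReal.toReal_mono hC hx⟩, rfl⟩)
  · rw [lintegral_const]
    exact ENNReal.mul_lt_top ENNReal.ofReal_lt_top (measure_lt_top _ _)

lemma midpointMeasure_comp {β : Type*} [MeasurableSpace β] (κ : Kernel α β) (μ ν : Measure α) :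
    midpointMeasure (μ.bind κ) (ν.bind κ) = (midpointMeasure μ ν).bind κ := by
  rw [midpointMeasure, midpointMeasure, Measure.bind_smul, Measure.comp_add]

lemma jsDiv_nonneg {b : ℝ} (hb : 1 ≤ b) (μ ν : Measure α) : 0 ≤ jsDiv b μ ν := by
  have := Real.log_nonneg hb
  unfold jsDiv klDivBase
  positivity

/-- Data processing inequality for the Jensen-Shannon divergence. -/
lemma jsDiv_comp_le {β : Type*} [MeasurableSpace β] {b : ℝ} (hb : 1 ≤ b) (κ : Kernel α β)
    [IsMarkovKernel κ] (μ ν : Measure α) [IsProbabilityMeasure μ] [IsProbabilityMeasure ν] :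
    jsDiv b (μ.bind κ) (ν.bind κ) ≤ jsDiv b μ ν := by
  have key : ∀ (μ ν : Measure α) [IsProbabilityMeasure μ] [IsProbabilityMeasure ν],
      klDivBase b (μ.bind κ) ((midpointMeasure μ ν).bind κ)
        ≤ klDivBase b μ (midpointMeasure μ ν) := fun μ ν _ _ =>
    div_le_div_of_nonneg_right (ENNReal.toReal_mono (klDiv_ne_top_of_le_smul _ _ (by simp)
      (le_two_smul_midpointMeasure μ ν)) (klDiv_comp_right_le ..)) (Real.log_nonneg hb)
  have h1 := key μ ν
  have h2 := key ν μ
  rw [midpointMeasure_comm ν μ] at h2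
  rw [jsDiv, jsDiv, midpointMeasure_comp]
  linarith

end Midpoint

/-! ### Jensen-Shannon divergence on a finite set. -/

section Finite
variable {𝒴 : Type*} [Fintype 𝒴] [MeasurableSpace 𝒴] [MeasurableSingletonClass 𝒴]

lemma rnDeriv_mul_singleton (μ ν : Measure 𝒴) [IsFiniteMeasure μ] [IsFiniteMeasure ν]
    (h : μ ≪ ν) (y : 𝒴) : μ.rnDeriv ν y * ν {y} = μ {y} := by
  rw [← Measure.setLIntegral_rnDeriv h, lintegral_singleton]

lemma toReal_klDiv_midpointMeasure (μ ν : Measure 𝒴) [IsProbabilityMeasure μ]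
    [IsProbabilityMeasure ν] :
    (klDiv μ (midpointMeasure μ ν)).toReal
      = Real.log 2 + ∑ y, (μ.real {y} * Real.log (μ.real {y})
          - μ.real {y} * Real.log (μ.real {y} + ν.real {y})) := by
  have hac := absolutelyContinuous_midpointMeasure μ ν
  rw [toReal_klDiv_of_measure_eq hac (by simp), integral_fintype .of_finite]
  have h1 : Real.log 2 = ∑ y, μ.real {y} * Real.log 2 := by
    rw [← Finset.sum_mul, sum_measureReal_singleton]; simp
  rw [h1, ← Finset.sum_add_distrib]
  refine Finset.sum_congr rfl fun y _ => ?_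
  have h2 := congrArg ENNReal.toReal (rnDeriv_mul_singleton μ _ hac y)
  have h3 : ((midpointMeasure μ ν) {y}).toReal = (μ.real {y} + ν.real {y}) / 2 := by
    simp only [midpointMeasure, Measure.smul_apply, Measure.add_apply, smul_eq_mul,
      ENNReal.toReal_mul, ENNReal.toReal_inv, ENNReal.toReal_ofNat]
    rw [ENNReal.toReal_add (by simp) (by simp)]
    simp only [measureReal_def]
    ring
  rw [ENNReal.toReal_mul, h3, ← measureReal_def μ] at h2
  rw [llr, smul_eq_mul]
  have hμ : 0 ≤ μ.real {y} := measureReal_nonneg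
  have hν : 0 ≤ ν.real {y} := measureReal_nonneg
  rcases hμ.eq_or_lt with h0 | h0
  · simp [← h0]
  have hs : 0 < μ.real {y} + ν.real {y} := by linarith
  have h4 : (μ.rnDeriv (midpointMeasure μ ν) y).toReal
      = μ.real {y} * 2 / (μ.real {y} + ν.real {y}) := by
    rw [eq_div_iff hs.ne']; linarith
  rw [h4, Real.log_div (by positivity) hs.ne', Real.log_mul h0.ne' (by simp)]
  ring

lemma jsDiv_eq_jsSum (b : ℝ) (μ ν : Measure 𝒴) [IsProbabilityMeasure μ]
    [IsProbabilityMeasure ν] :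
    jsDiv b μ ν
      = (Real.log 2 + 1 / 2 * jsSum (fun y => μ.real {y}) fun y => ν.real {y}) / Real.log b := by
  have h2 := toReal_klDiv_midpointMeasure ν μ
  rw [midpointMeasure_comm] at h2
  rw [jsDiv, klDivBase, klDivBase, toReal_klDiv_midpointMeasure, h2]
  have : jsSum (fun y => μ.real {y}) (fun y => ν.real {y})
      = ∑ y, (μ.real {y} * Real.log (μ.real {y})
          - μ.real {y} * Real.log (μ.real {y} + ν.real {y}))
        + ∑ y, (ν.real {y} * Real.log (ν.real {y})
          - ν.real {y} * Real.log (ν.real {y} + μ.real {y})) := by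
    rw [jsSum, ← Finset.sum_add_distrib]
    refine Finset.sum_congr rfl fun y _ => ?_
    rw [add_comm (ν.real {y})]
    ring
  rw [this]
  ring

end Finite

/-! ### Wrong predictions, label laws and expected error. -/

section Error
variable {𝒳 𝒜 𝒴 : Type*} [MeasurableSpace 𝒳] [MeasurableSpace 𝒜] [Fintype 𝒴]
  [MeasurableSpace 𝒴] [MeasurableSingletonClass 𝒴]

instance (D : Measure (𝒳 × 𝒜 × 𝒴)) [IsProbabilityMeasure D] : IsProbabilityMeasure (lawX D) :=
  Measure.isProbabilityMeasure_map (by fun_prop)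

instance (D : Measure (𝒳 × 𝒜 × 𝒴)) [IsProbabilityMeasure D] : IsProbabilityMeasure (lawY D) :=
  Measure.isProbabilityMeasure_map (by fun_prop)

/-- The probability that the stochastic predictor `k` wrongly predicts the label `y`. -/
noncomputable def wrongMass (k : Kernel 𝒳 𝒴) (D : Measure (𝒳 × 𝒜 × 𝒴)) (y : 𝒴) : ℝ :=
  ∫ w, {w : 𝒳 × 𝒜 × 𝒴 | w.2.2 ≠ y}.indicator (fun w => (k w.1).real {y}) w ∂D

omit [Fintype 𝒴] in
lemma measurable_measureReal_fst (k : Kernel 𝒳 𝒴) (y : 𝒴) :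
    Measurable fun w : 𝒳 × 𝒜 × 𝒴 => (k w.1).real {y} :=
  ((k.measurable_coe (measurableSet_singleton y)).comp measurable_fst).ennreal_toReal

omit [Fintype 𝒴] in
lemma measurableSet_label_ne (y : 𝒴) : MeasurableSet {w : 𝒳 × 𝒜 × 𝒴 | w.2.2 ≠ y} :=
  (measurable_snd.comp measurable_snd) (measurableSet_singleton y).compl

variable (k : Kernel 𝒳 𝒴) [IsMarkovKernel k] (D : Measure (𝒳 × 𝒜 × 𝒴))
  [IsProbabilityMeasure D]

omit [Fintype 𝒴] in
lemma integrable_measureReal_fst (y : 𝒴) :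
    Integrable (fun w : 𝒳 × 𝒜 × 𝒴 => (k w.1).real {y}) D :=
  .of_bound (measurable_measureReal_fst k y).aestronglyMeasurable 1
    (.of_forall fun w => by
      rw [Real.norm_of_nonneg measureReal_nonneg]; exact measureReal_le_one)

omit [Fintype 𝒴] in
lemma integrable_wrong (y : 𝒴) : Integrable
    ({w : 𝒳 × 𝒜 × 𝒴 | w.2.2 ≠ y}.indicator fun w => (k w.1).real {y}) D :=
  (integrable_measureReal_fst k D y).indicator (measurableSet_label_ne y)

omit [Fintype 𝒴] [MeasurableSingletonClass 𝒴] [IsMarkovKernel k]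
  [IsProbabilityMeasure D] in
lemma wrongMass_nonneg (y : 𝒴) : 0 ≤ wrongMass k D y :=
  integral_nonneg fun _ => Set.indicator_nonneg (fun _ _ => measureReal_nonneg) _

omit [Fintype 𝒴] [MeasurableSingletonClass 𝒴] [IsMarkovKernel k]
  [IsProbabilityMeasure D] in
lemma wrongMass_eq_zero [Subsingleton 𝒴] (y : 𝒴) : wrongMass k D y = 0 := by
  have : {w : 𝒳 × 𝒜 × 𝒴 | w.2.2 ≠ y} = ∅ := by
    ext w; simp [Subsingleton.elim w.2.2 y]
  simp [wrongMass, this]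

lemma sum_wrongMass_le_one : ∑ y, wrongMass k D y ≤ 1 := by
  have h : ∑ y, wrongMass k D y ≤ ∑ y, ∫ w, (k w.1).real {y} ∂D := by
    refine Finset.sum_le_sum fun y _ => integral_mono (integrable_wrong k D y)
      (integrable_measureReal_fst k D y) fun w => ?_
    exact Set.indicator_le_self' (fun _ _ => measureReal_nonneg) w
  rw [← integral_finsetSum _ fun y _ => integrable_measureReal_fst k D y] at h
  simpa using h

omit [Fintype 𝒴] [IsProbabilityMeasure D] in
lemma measureReal_bind_lawX (y : 𝒴) :
    ((lawX D).bind k).real {y} = ∫ w, (k w.1).real {y} ∂D := by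
  rw [measureReal_def, Measure.bind_apply (measurableSet_singleton y) k.aemeasurable, lawX,
    lintegral_map (k.measurable_coe (measurableSet_singleton y)) measurable_fst]
  exact (integral_toReal
    ((k.measurable_coe (measurableSet_singleton y)).comp measurable_fst).aemeasurable
    (.of_forall fun w => measure_lt_top _ _)).symm

/-- A prediction of y is either correct, and then the label is y, or counted in `wrongMass`. -/
lemma measureReal_bind_lawX_le (y : 𝒴) :
    ((lawX D).bind k).real {y} ≤ (lawY D).real {y} + wrongMass k D y := by
  have hs := (measurableSet_label_ne (𝒳 := 𝒳) (𝒜 := 𝒜) y).compl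
  have h : (lawY D).real {y}
      = ∫ w, {w : 𝒳 × 𝒜 × 𝒴 | w.2.2 ≠ y}ᶜ.indicator (fun _ => (1 : ℝ)) w ∂D := by
    rw [integral_indicator_const _ hs, smul_eq_mul, mul_one, lawY,
      map_measureReal_apply (by fun_prop) (measurableSet_singleton y)]
    congr 1
    ext w; simp
  rw [measureReal_bind_lawX, h, wrongMass, ← integral_add
    ((integrable_const _).indicator hs) (integrable_wrong k D y)]
  refine integral_mono (integrable_measureReal_fst k D y)
    (((integrable_const _).indicator hs).add (integrable_wrong k D y)) fun w => ?_
  by_cases hw : w.2.2 = y <;> simp [hw, measureReal_le_one]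

lemma mul_sum_wrongMass_le_expectedError {ℓ : stdSimplex ℝ 𝒴 → 𝒴 → ℝ} {L : 𝒴 → 𝒴 → ℝ} {c : ℝ}
    (hL_nonneg : ∀ y' y, 0 ≤ L y' y) (hL_off : ∀ y' y, y' ≠ y → c ≤ L y' y)
    (hℓ : ∀ x y, ℓ (simplexMap k x) y = ∑ y', simplexMap k x y' * L y' y) :
    c * ∑ y, wrongMass k D y ≤ expectedError ℓ (simplexMap k) D := by
  have hint : ∀ y', Integrable (fun w : 𝒳 × 𝒜 × 𝒴 => (k w.1).real {y'} * L y' w.2.2) D := by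
    intro y'
    have hL : Measurable fun w : 𝒳 × 𝒜 × 𝒴 => L y' w.2.2 :=
      (measurable_of_finite (L y')).comp (measurable_snd.comp measurable_snd)
    refine .of_bound ((measurable_measureReal_fst k y').mul hL).aestronglyMeasurable
      (∑ y, L y' y) (.of_forall fun w => ?_)
    rw [Real.norm_of_nonneg (mul_nonneg measureReal_nonneg (hL_nonneg _ _))]
    calc _ ≤ 1 * L y' w.2.2 :=
          mul_le_mul_of_nonneg_right measureReal_le_one (hL_nonneg _ _)
      _ ≤ _ := by
          rw [one_mul]
          exact Finset.single_le_sum (f := fun y => L y' y) (fun y _ => hL_nonneg y' y)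
            (Finset.mem_univ _)
  have he : expectedError ℓ (simplexMap k) D
      = ∑ y', ∫ w, (k w.1).real {y'} * L y' w.2.2 ∂D := by
    rw [← integral_finsetSum _ fun y' _ => hint y', expectedError]
    exact integral_congr_ae (.of_forall fun w => hℓ w.1 w.2.2)
  rw [he, Finset.mul_sum]
  refine Finset.sum_le_sum fun y _ => ?_
  rw [wrongMass, ← integral_const_mul]
  refine integral_mono ((integrable_wrong k D y).const_mul c) (hint y) fun w => ?_
  have h0 : 0 ≤ (k w.1).real {y} := measureReal_nonneg
  by_cases hw : w.2.2 = y
  · simpa [hw] using mul_nonneg h0 (hL_nonneg y y)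
  · simpa [hw, mul_comm c] using
      mul_le_mul_of_nonneg_left (hL_off y w.2.2 (Ne.symm hw)) h0

/-- Replacing the labels by the predictions decreases the Jensen-Shannon divergence between two
domains by at most a multiple of the square roots of the error probabilities. -/
lemma jsDiv_lawY_le {b : ℝ} (hb : 1 ≤ b) (D' : Measure (𝒳 × 𝒜 × 𝒴)) [IsProbabilityMeasure D'] :
    jsDiv b (lawY D) (lawY D') ≤ jsDiv b ((lawX D).bind k) ((lawX D').bind k)
      + (Real.sqrt (∑ y, wrongMass k D y) + Real.sqrt (∑ y, wrongMass k D' y)) / Real.log b := by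
  have key : ∀ (D : Measure (𝒳 × 𝒜 × 𝒴)) [IsProbabilityMeasure D] (μ : Measure 𝒴)
      [IsProbabilityMeasure μ],
      jsSum (fun y => (lawY D).real {y}) (fun y => μ.real {y})
        - jsSum (fun y => ((lawX D).bind k).real {y}) (fun y => μ.real {y})
        ≤ 2 * Real.sqrt (∑ y, wrongMass k D y) := fun D _ μ _ =>
    jsSum_sub_le (fun _ => measureReal_nonneg) (fun _ => measureReal_nonneg)
      (fun _ => measureReal_nonneg) (wrongMass_nonneg k D)
      (by rw [sum_measureReal_singleton]; simp) (measureReal_bind_lawX_le k D)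
      (sum_wrongMass_le_one k D)
  -- Hybrid argument: replace the labels of D against the true labels of D', then those of D'
  -- against the predictions of D.
  have h1 := key D (lawY D')
  have h2 := key D' ((lawX D).bind k)
  rw [jsSum_comm, jsSum_comm (fun y => ((lawX D').bind k).real {y})] at h2
  rw [jsDiv_eq_jsSum, jsDiv_eq_jsSum, ← add_div]
  exact div_le_div_of_nonneg_right (by linarith) (Real.log_nonneg hb)

end Error

/-! ### From divergences to the fourth power of distances. -/

section Bound
variable {𝒳 𝒜 𝒴 𝒵 : Type*} [MeasurableSpace 𝒳] [MeasurableSpace 𝒜] [Fintype 𝒴]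
  [MeasurableSpace 𝒴] [MeasurableSingletonClass 𝒴] [MeasurableSpace 𝒵]

lemma jsDist_sub_pow_four_le {b : ℝ} (hb : 2 ≤ b) (g : Kernel 𝒳 𝒵) [IsMarkovKernel g]
    (h : Kernel 𝒵 𝒴) [IsMarkovKernel h] (D D' : Measure (𝒳 × 𝒜 × 𝒴)) [IsProbabilityMeasure D]
    [IsProbabilityMeasure D']
    (hJS : jsDist b (lawZ g D) (lawZ g D') ≤ jsDist b (lawY D) (lawY D')) :
    (jsDist b (lawY D) (lawY D') - jsDist b (lawZ g D) (lawZ g D')) ^ 4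
      ≤ 4 * Fintype.card 𝒴 *
        (∑ y, wrongMass (h ∘ₖ g) D y + ∑ y, wrongMass (h ∘ₖ g) D' y) := by
  have hb1 : 1 ≤ b := by linarith
  have h1 := jsDiv_lawY_le (h ∘ₖ g) D hb1 D'
  have hP : ∀ (D : Measure (𝒳 × 𝒜 × 𝒴)) [IsProbabilityMeasure D],
      IsProbabilityMeasure (lawZ g D) := fun D _ => by unfold lawZ; infer_instance
  have := hP D
  have := hP D'
  have h2 : jsDiv b ((lawX D).bind (h ∘ₖ g)) ((lawX D').bind (h ∘ₖ g))
      ≤ jsDiv b (lawZ g D) (lawZ g D') := by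
    simpa only [lawZ, Measure.comp_assoc] using jsDiv_comp_le hb1 h (lawZ g D) (lawZ g D')
  set e := ∑ y, wrongMass (h ∘ₖ g) D y
  set e' := ∑ y, wrongMass (h ∘ₖ g) D' y
  have he : 0 ≤ e := Finset.sum_nonneg fun y _ => wrongMass_nonneg _ D y
  have he' : 0 ≤ e' := Finset.sum_nonneg fun y _ => wrongMass_nonneg _ D' y
  have hlog : 1 / 2 ≤ Real.log b := by
    have := Real.log_le_log (by norm_num) hb
    have := Real.log_two_gt_d9
    linarith
  set t := (Real.sqrt e + Real.sqrt e') / Real.log b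
  set a := jsDist b (lawY D) (lawY D')
  set d := jsDist b (lawZ g D) (lawZ g D')
  have ha : a ^ 2 = jsDiv b (lawY D) (lawY D') := Real.sq_sqrt (jsDiv_nonneg hb1 _ _)
  have hd : d ^ 2 = jsDiv b (lawZ g D) (lawZ g D') := Real.sq_sqrt (jsDiv_nonneg hb1 _ _)
  have hd0 : 0 ≤ d := Real.sqrt_nonneg _
  -- From 0 ≤ d ≤ a: (a - d)² ≤ (a - d)(a + d) = a² - d².
  have hsq : (a - d) ^ 2 ≤ t := by nlinarith
  have hpow : (a - d) ^ 4 ≤ t ^ 2 := by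
    calc (a - d) ^ 4 = ((a - d) ^ 2) ^ 2 := by ring
      _ ≤ t ^ 2 := pow_le_pow_left₀ (sq_nonneg _) hsq 2
  refine hpow.trans ?_
  have ht : t ^ 2 ≤ 8 * (e + e') := by
    have ht1 : t ≤ 2 * (Real.sqrt e + Real.sqrt e') := by
      rw [div_le_iff₀ (by linarith)]
      nlinarith [Real.sqrt_nonneg e, Real.sqrt_nonneg e']
    have ht0 : 0 ≤ t := by positivity
    nlinarith [Real.sq_sqrt he, Real.sq_sqrt he', sq_nonneg (Real.sqrt e - Real.sqrt e')]
  -- The constant 8 is at most 4|𝒴| once there are two labels; with a single label no prediction is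
  -- wrong.
  rcases subsingleton_or_nontrivial 𝒴 with hY | hY
  · have : e = 0 := Finset.sum_eq_zero fun y _ => wrongMass_eq_zero _ D y
    have : e' = 0 := Finset.sum_eq_zero fun y _ => wrongMass_eq_zero _ D' y
    simp_all
  · have hcard : (2 : ℝ) ≤ Fintype.card 𝒴 := by
      exact_mod_cast Fintype.one_lt_card (α := 𝒴)
    nlinarith

end Bound

end DomainGeneralization

/-! ### The averaged bound. -/

open DomainGeneralization in
theorem theorem2 {𝒳 𝒜 𝒴 𝒵 : Type*} [MeasurableSpace 𝒳] [MeasurableSpace 𝒜]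
    [Fintype 𝒴] [MeasurableSpace 𝒴] [MeasurableSingletonClass 𝒴] [MeasurableSpace 𝒵]
    -- the base of the logarithm
    (b : ℝ) (hb : 2 ≤ b)
    -- source domains and target domain
    (N : ℕ) (hN : 0 < N)
    (DS : Fin N → Measure (𝒳 × 𝒜 × 𝒴)) [∀ i, IsProbabilityMeasure (DS i)]
    (DT : Measure (𝒳 × 𝒜 × 𝒴)) [IsProbabilityMeasure DT]
    -- stochastic representation mapping and hypothesis on the representation space
    (g : Kernel 𝒳 𝒵) [IsMarkovKernel g] (h : Kernel 𝒵 𝒴) [IsMarkovKernel h]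
    -- the predictor is the composition of the two
    (f : 𝒳 → stdSimplex ℝ 𝒴) (hf : f = simplexMap (h ∘ₖ g))
    -- the loss
    (ℓ : stdSimplex ℝ 𝒴 → 𝒴 → ℝ) (L : 𝒴 → 𝒴 → ℝ) (c : ℝ)
    (hL_nonneg : ∀ y' y, 0 ≤ L y' y)
    (hL_off : ∀ y' y, y' ≠ y → c ≤ L y' y)
    (hL_diag : ∀ y, L y y = 0)
    (hℓ : ∀ x y, ℓ (f x) y = ∑ y', f x y' * L y' y)
    (hJS : ∀ i, jsDist b (lawZ g (DS i)) (lawZ g DT) ≤ jsDist b (lawY (DS i)) (lawY DT)) :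
    c / (4 * (Fintype.card 𝒴 : ℝ) * (N : ℝ)) *
        ∑ i, (jsDist b (lawY (DS i)) (lawY DT) - jsDist b (lawZ g (DS i)) (lawZ g DT)) ^ 4
      ≤ 1 / (N : ℝ) * ∑ i, expectedError ℓ f (DS i) + expectedError ℓ f DT := by
  subst hf
  have hN' : (0 : ℝ) < N := by exact_mod_cast hN
  have herr : ∀ (D : Measure (𝒳 × 𝒜 × 𝒴)), 0 ≤ expectedError ℓ (simplexMap (h ∘ₖ g)) D :=
    fun D => integral_nonneg fun w => by
      rw [Pi.zero_apply, hℓ]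
      exact Finset.sum_nonneg fun y' _ =>
        mul_nonneg ((simplexMap (h ∘ₖ g) w.1).2.1 y') (hL_nonneg _ _)
  -- The sign of c is not assumed; for c ≤ 0 the left side is nonpositive.
  rcases le_or_gt c 0 with hc | hc
  · have h1 : 0 ≤ 1 / (N : ℝ) * ∑ i, expectedError ℓ (simplexMap (h ∘ₖ g)) (DS i) :=
      mul_nonneg (by positivity) (Finset.sum_nonneg fun i _ => herr _)
    refine le_trans (mul_nonpos_of_nonpos_of_nonneg
      (div_nonpos_of_nonpos_of_nonneg hc (by positivity))
      (Finset.sum_nonneg fun i _ => by positivity)) (add_nonneg h1 (herr _))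
  have hY : Nonempty 𝒴 := by
    obtain ⟨w⟩ := nonempty_of_isProbabilityMeasure DT
    exact ⟨w.2.2⟩
  have hcard : (0 : ℝ) < Fintype.card 𝒴 := by exact_mod_cast Fintype.card_pos
  have key : ∀ i, c / (4 * (Fintype.card 𝒴 : ℝ) * N) *
      (jsDist b (lawY (DS i)) (lawY DT) - jsDist b (lawZ g (DS i)) (lawZ g DT)) ^ 4
      ≤ 1 / (N : ℝ) * (expectedError ℓ (simplexMap (h ∘ₖ g)) (DS i)
        + expectedError ℓ (simplexMap (h ∘ₖ g)) DT) := fun i => by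
    have hS := mul_sum_wrongMass_le_expectedError (h ∘ₖ g) (DS i) hL_nonneg hL_off hℓ
    have hT := mul_sum_wrongMass_le_expectedError (h ∘ₖ g) DT hL_nonneg hL_off hℓ
    calc _ ≤ c / (4 * (Fintype.card 𝒴 : ℝ) * N) * (4 * Fintype.card 𝒴 *
          (∑ y, wrongMass (h ∘ₖ g) (DS i) y + ∑ y, wrongMass (h ∘ₖ g) DT y)) :=
        mul_le_mul_of_nonneg_left (jsDist_sub_pow_four_le hb g h (DS i) DT (hJS i))
          (by positivity)
      _ = 1 / (N : ℝ) * (c * ∑ y, wrongMass (h ∘ₖ g) (DS i) y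
          + c * ∑ y, wrongMass (h ∘ₖ g) DT y) := by field_simp
      _ ≤ _ := mul_le_mul_of_nonneg_left (add_le_add hS hT) (by positivity)
  rw [Finset.mul_sum]
  refine (Finset.sum_le_sum fun i _ => key i).trans_eq ?_
  rw [← Finset.mul_sum, Finset.sum_add_distrib, Finset.sum_const, Finset.card_univ,
    Fintype.card_fin, nsmul_eq_mul]
  field_simp
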